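/- All rings are commutative with identity, and ring homomorphisms preserve the identity. Let $C$ be a commutative ring and fix $\lambda\in C$. A Baxter $C$-algebra of weight $\lambda$ is a pair $(R,P)$ of a commutative $C$-algebra $R$ and a $C$-linear map $P:R\to R$ with $P(x)P(y)=P(xP(y))+P(yP(x))+\lambda P(xy)$ for all $x,y\in R$; its homomorphisms are the $C$-algebra homomorphisms that commute with the operators. Let $\mathbf{Alg}_C$ be the category of commutative $C$-algebras and $\mathbf{Bax}_{C}$ the category of Baxter $C$-algebras of weight $\lambda$. For a commutative $C$-algebra $A$, let $Ш_C(A)=\bigoplus_{k\ge 0}A^{\otimes(k+1)}$ (tensor powers over $C$) with the mixable shuffle product $$(x_0\otimes x_1\otimes\cdots\otimes x_m)(y_0\otimes y_1\otimes\cdots\otimes y_n)=\sum_{(\sigma,T)}\lambda^{|T|}\,x_0y_0\otimes\sigma(x^+\otimes y^+;T).$$ Here $\sigma$ runs over the permutations of $\{1,\dots,m+n\}$ with $\sigma^{-1}(1)<\cdots<\sigma^{-1}(m)$ and $\sigma^{-1}(m+1)<\cdots<\sigma^{-1}(m+n)$, $T$ runs over the sets of pairs $(k,k+1)$ with $\sigma(k)\le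 m<\sigma(k+1)$, and, with $(u_1,\dots,u_{m+n})=(x_1,\dots,x_m,y_1,\dots,y_n)$, $\sigma(x^+\otimes y^+;T)$ is obtained from $u_{\sigma(1)}\otimes\cdots\otimes u_{\sigma(m+n)}$ by multiplying the $k$-th and $(k+1)$-st factors for every $(k,k+1)\in T$. With the operator $P_A(x_0\otimes\cdots\otimes x_k)=1\otimes x_0\otimes\cdots\otimes x_k$, this is a Baxter $C$-algebra of weight $\lambda$, and $A\mapsto(Ш_C(A),P_A)$, $f\mapsto Ш_C(f)=\bigoplus_{k\ge 0} f^{\otimes(k+1)}$ is a functor $\mathbf{Alg}_C\to\mathbf{Bax}_{C}$. Let $\Lambda$ be a small category and $F:\Lambda\to\mathbf{Alg}_C$, $i\mapsto A_i$, a functor. Then the colimit of $i\mapsto(Ш_C(A_i),P_{A_i})$ exists in $\mathbf{Bax}_{C}$ and $$\operatorname{colim}_i\,(Ш_C(A_i),P_{A_i})\cong\bigl(Ш_C(\operatorname{colim}_iA_i),P_{\operatorname{colim}_iA_i}\bigr)$$ by an isomorphism compatible with the canonical maps from the $(Ш_C(A_i),P_{A_i})$. That is, $Ш_C$ carries every colimit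 cocone of $F$ to a colimit cocone. In particular, for all commutative $C$-algebras $A$ and $B$, $Ш_C(A\otimes_C B)$, with the maps induced by $a\mapsto a\otimes 1$ and $b\mapsto 1\otimes b$, is the coproduct of $Ш_C(A)$ and $Ш_C(B)$ in $\mathbf{Bax}_{C}$. -/

import Mathlib

open CategoryTheory Limits TensorProduct DirectSum

universe u v

noncomputable section

namespace Baxter

section Words

variable (C : Type u) [CommRing C] (A : Type v) [CommRing A] [Algebra C A]

/-- The module of words `⨁_{k ≥ 0} A^{⊗ k}`. -/
abbrev Words : Type (max u v) := ⨁ k : ℕ, ⨂[C]^k A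

variable {A}

/-- The bilinear map `A × A^{⊗ n} → A^{⊗ (n+1)}`, `(a, w) ↦ a ⊗ w`. -/
def consPow (n : ℕ) : A →ₗ[C] (⨂[C]^n A) →ₗ[C] ⨂[C]^(n + 1) A :=
  (PiTensorProduct.lift (R := C) (s := fun _ : Fin n => A)).toLinearMap ∘ₗ
    (PiTensorProduct.tprod C (s := fun _ : Fin (n + 1) => A)).curryLeft

theorem consPow_tprod (n : ℕ) (a : A) (x : Fin n → A) :
    consPow C n a (PiTensorProduct.tprod C x) =
      PiTensorProduct.tprod C (Fin.cons a x : Fin (n + 1) → A) := by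
  simp [consPow]

/-- The linear map on `A^{⊗ (n+1)}` given by `a ⊗ w ↦ f a w`, for a bilinear map `f` on
`A × A^{⊗ n}`. -/
def uncons {M : Type*} [AddCommGroup M] [Module C M] (n : ℕ) :
    (A →ₗ[C] (⨂[C]^n A) →ₗ[C] M) →ₗ[C] (⨂[C]^(n + 1) A) →ₗ[C] M :=
  (PiTensorProduct.lift (R := C) (s := fun _ : Fin (n + 1) => A)).toLinearMap ∘ₗ
    (multilinearCurryLeftEquiv C (fun _ : Fin (n + 1) => A) M).symm.toLinearMap ∘ₗ
    (LinearMap.compRight C (PiTensorProduct.lift (R := C) (s := fun _ : Fin n => A)).symm.toLinearMap)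

theorem uncons_consPow {M : Type*} [AddCommGroup M] [Module C M] (n : ℕ)
    (f : A →ₗ[C] (⨂[C]^n A) →ₗ[C] M) (a : A) (w : ⨂[C]^n A) :
    uncons C n f (consPow C n a w) = f a w := by
  have : uncons C n f ∘ₗ consPow C n a = f a := by
    apply PiTensorProduct.ext
    ext x
    simp only [uncons, LinearMap.compMultilinearMap_apply, LinearMap.comp_apply, consPow_tprod,
      LinearEquiv.coe_coe, PiTensorProduct.lift.tprod]
    rfl
  exact LinearMap.congr_fun this w

theorem tprod_succ (n : ℕ) (x : Fin (n + 1) → A) :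
    PiTensorProduct.tprod C x = consPow C n (x 0) (PiTensorProduct.tprod C (Fin.tail x)) := by
  rw [consPow_tprod, Fin.cons_self_tail]

/-- Prepending a letter to a word. -/
def cons : A →ₗ[C] Words C A →ₗ[C] Words C A :=
  LinearMap.flip (DirectSum.toModule C ℕ _ fun n =>
    ((consPow C n).compr₂ (DirectSum.lof C ℕ (fun k => ⨂[C]^k A) (n + 1))).flip)

theorem cons_lof (n : ℕ) (a : A) (w : ⨂[C]^n A) :
    cons C a (DirectSum.lof C ℕ (fun k => ⨂[C]^k A) n w) =
      DirectSum.lof C ℕ (fun k => ⨂[C]^k A) (n + 1) (consPow C n a w) := by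
  simp [cons]

variable (A) in
/-- The empty word. -/
def emptyWord : Words C A :=
  DirectSum.lof C ℕ (fun k => ⨂[C]^k A) 0 (PiTensorProduct.tprod C Fin.elim0)

/-- The pure tensor `x₁ ⊗ ⋯ ⊗ xₙ`, for a list of letters. -/
def word : List A → Words C A
  | [] => emptyWord C A
  | a :: l => cons C a (word l)

theorem word_ofFn (n : ℕ) (x : Fin n → A) :
    word C (List.ofFn x) =
      DirectSum.lof C ℕ (fun k => ⨂[C]^k A) n (PiTensorProduct.tprod C x) := by
  induction n with
  | zero =>
    simp only [List.ofFn_zero, word, emptyWord]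
    congr 2
    exact Subsingleton.elim _ _
  | succ n ih =>
    rw [List.ofFn_succ, word, ih, cons_lof, tprod_succ C n x]
    rfl

theorem words_hom_ext {M : Type*} [AddCommGroup M] [Module C M] {f g : Words C A →ₗ[C] M}
    (h : ∀ l, f (word C l) = g (word C l)) : f = g := by
  apply DirectSum.linearMap_ext
  intro n
  apply PiTensorProduct.ext
  ext x
  have := h (List.ofFn x)
  rw [word_ofFn] at this
  exact this

/-- Components of the mixable shuffle product of `x₁ ⊗ ⋯ ⊗ xₘ` and `y₁ ⊗ ⋯ ⊗ yₙ`, sorted by the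
first letter of the result, which is `x₁`, or `y₁`, or (with coefficient the weight) `x₁ y₁`. -/
def shufflePow (wt : C) : (m n : ℕ) → (⨂[C]^m A) →ₗ[C] (⨂[C]^n A) →ₗ[C] Words C A
  | 0, n => (LinearMap.lsmul C ((⨂[C]^n A) →ₗ[C] Words C A)).flip
      (DirectSum.lof C ℕ (fun k => ⨂[C]^k A) n) ∘ₗ
      (PiTensorProduct.isEmptyEquiv (R := C) (s := fun _ : Fin 0 => A) (Fin 0)).toLinearMap
  | m + 1, 0 => ((LinearMap.lsmul C ((⨂[C]^(m + 1) A) →ₗ[C] Words C A)).flip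
      (DirectSum.lof C ℕ (fun k => ⨂[C]^k A) (m + 1)) ∘ₗ
      (PiTensorProduct.isEmptyEquiv (R := C) (s := fun _ : Fin 0 => A) (Fin 0)).toLinearMap).flip
  | m + 1, n + 1 =>
      uncons C m (LinearMap.mk₂ C (fun a u => cons C a ∘ₗ shufflePow wt m (n + 1) u)
        (by intros; ext; simp) (by intros; ext; simp) (by intros; ext; simp)
        (by intros; ext; simp)) +
      (uncons C n (LinearMap.mk₂ C (fun b v => cons C b ∘ₗ (shufflePow wt (m + 1) n).flip v)
        (by intros; ext; simp) (by intros; ext; simp) (by intros; ext; simp)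
        (by intros; ext; simp))).flip +
      wt • uncons C m (LinearMap.mk₂ C (fun a u => uncons C n
          ((cons C ∘ₗ LinearMap.mulLeft C a).compl₂ (shufflePow wt m n u)))
        (by intros; rw [← map_add]; congr 1; ext; simp [add_mul])
        (by intros; rw [← map_smul]; congr 1; ext; simp)
        (by intros; rw [← map_add]; congr 1; ext; simp)
        (by intros; rw [← map_smul]; congr 1; ext; simp))
  termination_by m n => (m, n)

variable (A) in
/-- The mixable shuffle product of words, as a bilinear map. -/
def shuffle (wt : C) : Words C A →ₗ[C] Words C A →ₗ[C] Words C A :=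
  DirectSum.toModule C ℕ _ fun m => LinearMap.flip <|
    DirectSum.toModule C ℕ _ fun n => (shufflePow C wt m n).flip

theorem shuffle_lof (wt : C) (m n : ℕ) (u : ⨂[C]^m A) (v : ⨂[C]^n A) :
    shuffle C A wt (DirectSum.lof C ℕ (fun k => ⨂[C]^k A) m u)
      (DirectSum.lof C ℕ (fun k => ⨂[C]^k A) n v) = shufflePow C wt m n u v := by
  simp [shuffle]

theorem emptyWord_shuffle (wt : C) (w : Words C A) : shuffle C A wt (emptyWord C A) w = w := by
  suffices h : shuffle C A wt (emptyWord C A) = LinearMap.id from LinearMap.congr_fun h w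
  apply DirectSum.linearMap_ext
  intro n
  refine LinearMap.ext fun v => ?_
  simp only [LinearMap.comp_apply, emptyWord, shuffle_lof, shufflePow]
  simp

theorem shuffle_emptyWord (wt : C) (w : Words C A) : shuffle C A wt w (emptyWord C A) = w := by
  suffices h : (shuffle C A wt).flip (emptyWord C A) = LinearMap.id from LinearMap.congr_fun h w
  apply DirectSum.linearMap_ext
  intro n
  refine LinearMap.ext fun v => ?_
  cases n with
  | zero =>
    simp only [LinearMap.comp_apply, LinearMap.flip_apply, emptyWord, shuffle_lof, shufflePow]
    simp only [LinearMap.lsmul_apply, LinearMap.smul_apply, LinearMap.id_apply, LinearEquiv.coe_coe]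
    rw [← map_smul]
    congr 1
    apply (PiTensorProduct.isEmptyEquiv (R := C) (s := fun _ : Fin 0 => A) (Fin 0)).injective
    simp
  | succ n =>
    simp only [LinearMap.comp_apply, LinearMap.flip_apply, emptyWord, shuffle_lof, shufflePow]
    simp

theorem cons_shuffle_cons (wt : C) (a b : A) (u v : Words C A) :
    shuffle C A wt (cons C a u) (cons C b v) =
      cons C a (shuffle C A wt u (cons C b v)) + cons C b (shuffle C A wt (cons C a u) v) +
        wt • cons C (a * b) (shuffle C A wt u v) := by
  induction u using DirectSum.induction_on with
  | zero => simp
  | add x y hx hy => simp only [map_add, LinearMap.add_apply, hx, hy, smul_add]; abel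
  | of m u =>
    induction v using DirectSum.induction_on with
    | zero => simp
    | add x y hx hy => simp only [map_add, hx, hy, smul_add]; abel
    | of n v =>
      change shuffle C A wt (cons C a (DirectSum.lof C ℕ (fun k => ⨂[C]^k A) m u))
        (cons C b (DirectSum.lof C ℕ (fun k => ⨂[C]^k A) n v)) =
        cons C a (shuffle C A wt (DirectSum.lof C ℕ (fun k => ⨂[C]^k A) m u)
          (cons C b (DirectSum.lof C ℕ (fun k => ⨂[C]^k A) n v))) +
        cons C b (shuffle C A wt (cons C a (DirectSum.lof C ℕ (fun k => ⨂[C]^k A) m u))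
          (DirectSum.lof C ℕ (fun k => ⨂[C]^k A) n v)) +
        wt • cons C (a * b) (shuffle C A wt (DirectSum.lof C ℕ (fun k => ⨂[C]^k A) m u)
          (DirectSum.lof C ℕ (fun k => ⨂[C]^k A) n v))
      simp only [cons_lof, shuffle_lof]
      conv_lhs => rw [shufflePow]
      simp only [LinearMap.add_apply, LinearMap.smul_apply, LinearMap.flip_apply, uncons_consPow,
        LinearMap.mk₂_apply, LinearMap.comp_apply, LinearMap.compl₂_apply,
        LinearMap.mulLeft_apply]

/-- A linear condition on a word may be checked on pure tensors. -/
theorem words_induction {p : Words C A → Prop} (w : Words C A) (hw : ∀ l, p (word C l))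
    (hadd : ∀ u v, p u → p v → p (u + v)) (hsmul : ∀ (c : C) u, p u → p (c • u)) : p w := by
  have h0 : p 0 := by simpa using hsmul 0 _ (hw [])
  induction w using DirectSum.induction_on with
  | zero => exact h0
  | add x y hx hy => exact hadd _ _ hx hy
  | of n w =>
    change p (DirectSum.lof C ℕ (fun k => ⨂[C]^k A) n w)
    induction w using PiTensorProduct.induction_on with
    | smul_tprod r f => rw [map_smul, ← word_ofFn]; exact hsmul _ _ (hw _)
    | add x y hx hy => rw [map_add]; exact hadd _ _ hx hy

theorem shuffle_comm_word (wt : C) : ∀ k l : List A,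
    shuffle C A wt (word C k) (word C l) = shuffle C A wt (word C l) (word C k)
  | [], l => by rw [word, emptyWord_shuffle, shuffle_emptyWord]
  | _ :: _, [] => by rw [word.eq_1 C, emptyWord_shuffle, shuffle_emptyWord]
  | a :: k, b :: l => by
    have h1 := shuffle_comm_word wt k (b :: l)
    have h2 := shuffle_comm_word wt (a :: k) l
    have h3 := shuffle_comm_word wt k l
    simp only [word] at h1 h2 ⊢
    rw [cons_shuffle_cons, cons_shuffle_cons, h1, h2, h3, mul_comm a b]
    abel
  termination_by k l => k.length + l.length

theorem shuffle_comm (wt : C) (u v : Words C A) : shuffle C A wt u v = shuffle C A wt v u := by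
  induction u using words_induction with
  | hw k =>
    induction v using words_induction with
    | hw l => exact shuffle_comm_word C wt k l
    | hadd u v hu hv => simp [hu, hv]
    | hsmul c u hu => simp [hu]
  | hadd u v hu hv => simp [hu, hv]
  | hsmul c u hu => simp [hu]

theorem shuffle_assoc_word (wt : C) : ∀ k l m : List A,
    shuffle C A wt (shuffle C A wt (word C k) (word C l)) (word C m) =
      shuffle C A wt (word C k) (shuffle C A wt (word C l) (word C m))
  | [], l, m => by rw [word, emptyWord_shuffle, emptyWord_shuffle]
  | _ :: _, [], m => by rw [word.eq_1 C, emptyWord_shuffle, shuffle_emptyWord]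
  | _ :: _, _ :: _, [] => by rw [word.eq_1 C, shuffle_emptyWord, shuffle_emptyWord]
  | a :: k, b :: l, c :: m => by
    have h1 := shuffle_assoc_word wt k (b :: l) (c :: m)
    have h2 := shuffle_assoc_word wt (a :: k) l (c :: m)
    have h3 := shuffle_assoc_word wt (a :: k) (b :: l) m
    have h4 := shuffle_assoc_word wt k l (c :: m)
    have h5 := shuffle_assoc_word wt k (b :: l) m
    have h6 := shuffle_assoc_word wt (a :: k) l m
    have h7 := shuffle_assoc_word wt k l m
    simp only [word] at h1 h2 h3 h4 h5 h6 ⊢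
    have e1 := congrArg (cons C a) h1
    have e2 := congrArg (cons C b) h2
    have e3 := congrArg (cons C c) h3
    have e4 := congrArg (cons C (a * b)) h4
    have e5 := congrArg (cons C (a * c)) h5
    have e6 := congrArg (cons C (b * c)) h6
    have e7 := congrArg (cons C (a * (b * c))) h7
    simp only [cons_shuffle_cons, map_add, map_smul, LinearMap.add_apply, LinearMap.smul_apply,
      mul_assoc] at e1 e2 e3 e4 e5 e6 e7 ⊢
    linear_combination (norm := module) e1 + e2 + e3 + wt • e4 + wt • e5 + wt • e6 + (wt * wt) • e7
  termination_by k l m => k.length + l.length + m.length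

theorem shuffle_assoc (wt : C) (u v w : Words C A) :
    shuffle C A wt (shuffle C A wt u v) w = shuffle C A wt u (shuffle C A wt v w) := by
  induction u using words_induction with
  | hw k =>
    induction v using words_induction with
    | hw l =>
      induction w using words_induction with
      | hw m => exact shuffle_assoc_word C wt k l m
      | hadd u v hu hv => simp only [map_add, hu, hv]
      | hsmul c u hu => simp only [map_smul, hu]
    | hadd u v hu hv => simp only [map_add, LinearMap.add_apply, hu, hv]
    | hsmul c u hu => simp only [map_smul, LinearMap.smul_apply, hu]
  | hadd u v hu hv => simp only [map_add, LinearMap.add_apply, hu, hv]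
  | hsmul c u hu => simp only [map_smul, LinearMap.smul_apply, hu]

end Words

section MixableShuffles

/-- `(m,n)`-shuffles: permutations `σ` with `σ⁻¹(1) < ⋯ < σ⁻¹(m)` and
`σ⁻¹(m+1) < ⋯ < σ⁻¹(m+n)` (indices here start from `0`). -/
def IsShuffle (m n : ℕ) (σ : Equiv.Perm (Fin (m + n))) : Prop :=
  StrictMono (fun i : Fin m => σ.symm (Fin.castAdd n i)) ∧
    StrictMono (fun j : Fin n => σ.symm (Fin.natAdd m j))

open scoped Classical in
/-- The finite set of `(m,n)`-shuffles. -/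
def shuffles (m n : ℕ) : Finset (Equiv.Perm (Fin (m + n))) :=
  Finset.univ.filter (IsShuffle m n)

open scoped Classical in
/-- The admissible pairs `(k, k+1)` of `σ`, those with `σ(k) ≤ m < σ(k+1)`, represented by `k`
(indices here start from `0`, so that the condition reads `σ(k) < m ≤ σ(k+1)`). -/
def admissible (m n : ℕ) (σ : Equiv.Perm (Fin (m + n))) : Finset ℕ :=
  (Finset.range (m + n)).filter fun k =>
    ∃ h : k + 1 < m + n, (σ ⟨k, Nat.lt_of_succ_lt h⟩ : ℕ) < m ∧ m ≤ (σ ⟨k + 1, h⟩ : ℕ)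

/-- The list of tensor factors of `u₀ ⊗̂ u₁ ⊗̂ ⋯`, where the `i`-th and the `(i+1)`-st entry are
multiplied if `i ∈ T`. The second argument is the position of the first entry of the list. -/
def contract {A : Type v} [Mul A] (T : Finset ℕ) : ℕ → List A → List A
  | _, [] => []
  | _, [a] => [a]
  | k, a :: b :: l => if k ∈ T then contract T (k + 1) (a * b :: l)
      else a :: contract T (k + 1) (b :: l)
  termination_by _ l => l.length

theorem contract_of_notMem {A : Type v} [Mul A] {T : Finset ℕ} {k : ℕ} (hk : k ∉ T) (a : A)
    (l : List A) : contract T k (a :: l) = a :: contract T (k + 1) l := by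
  cases l with
  | nil => simp [contract]
  | cons b l => simp [contract, hk]

theorem contract_congr {A : Type v} [Mul A] {S T : Finset ℕ} :
    ∀ (k : ℕ) (l : List A), (∀ i, k ≤ i → (i ∈ S ↔ i ∈ T)) → contract S k l = contract T k l
  | _, [], _ => by simp [contract]
  | _, [a], _ => by simp [contract]
  | k, a :: b :: l, h => by
    have h' : ∀ i, k + 1 ≤ i → (i ∈ S ↔ i ∈ T) := fun i hi => h i (by omega)
    rw [contract, contract, contract_congr (k + 1) (a * b :: l) h',
      contract_congr (k + 1) (b :: l) h']
    simp only [h k le_rfl]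
  termination_by _ l => l.length

/-- Positions of the admissible pairs in a list of letters, where the letters below `m` belong to
the first word. -/
def admList (m : ℕ) : ℕ → List ℕ → Finset ℕ
  | _, [] => ∅
  | _, [_] => ∅
  | k, a :: b :: w => if a < m ∧ m ≤ b then insert k (admList m (k + 1) (b :: w))
      else admList m (k + 1) (b :: w)

theorem mem_admList (m : ℕ) : ∀ (k : ℕ) (w : List ℕ) (i : ℕ), i ∈ admList m k w ↔
    k ≤ i ∧ ∃ h : i - k + 1 < w.length, w[i - k] < m ∧ m ≤ w[i - k + 1]
  | k, [], i => by simp [admList]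
  | k, [a], i => by simp [admList]
  | k, a :: b :: w, i => by
    have ih := mem_admList m (k + 1) (b :: w) i
    rcases lt_trichotomy i k with h | rfl | h
    · rw [admList]
      split_ifs
      · rw [Finset.mem_insert, ih]
        constructor
        · rintro (h' | h') <;> omega
        · rintro ⟨h', -⟩; omega
      · rw [ih]
        constructor
        · rintro h'; omega
        · rintro ⟨h', -⟩; omega
    · rw [admList]
      split_ifs with hab
      · simp [hab]
      · rw [ih]
        simp
        simpa using hab
    · obtain ⟨j, rfl⟩ : ∃ j, i = k + 1 + j := ⟨i - (k + 1), by omega⟩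
      have e1 : k + 1 + j - (k + 1) = j := by omega
      have e2 : k + 1 + j - k = j + 1 := by omega
      rw [admList]
      simp only [e1, e2, List.length_cons, List.getElem_cons_succ] at ih ⊢
      split_ifs with hab
      · rw [Finset.mem_insert, ih]
        constructor
        · rintro (h' | ⟨-, h1, h2⟩)
          · omega
          · exact ⟨by omega, by omega, h2⟩
        · rintro ⟨-, h1, h2⟩
          exact Or.inr ⟨by omega, by omega, h2⟩
      · rw [ih]
        constructor
        · rintro ⟨-, h1, h2⟩
          exact ⟨by omega, by omega, h2⟩
        · rintro ⟨-, h1, h2⟩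
          exact ⟨by omega, by omega, h2⟩

/-- All interleavings of two lists. -/
def interleavings : List ℕ → List ℕ → List (List ℕ)
  | [], l => [l]
  | a :: k, [] => [a :: k]
  | a :: k, b :: l => (interleavings k (b :: l)).map (a :: ·) ++
      (interleavings (a :: k) l).map (b :: ·)
  termination_by k l => k.length + l.length

theorem mem_interleavings (m : ℕ) : ∀ (k l w : List ℕ), (∀ a ∈ k, a < m) → (∀ b ∈ l, m ≤ b) →
    (w ∈ interleavings k l ↔ w.filter (· < m) = k ∧ w.filter (m ≤ ·) = l)
  | [], l, w, _, hl => by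
    simp only [interleavings, List.mem_singleton, List.filter_eq_nil_iff]
    constructor
    · rintro rfl
      refine ⟨fun a ha => by simpa using hl a ha, ?_⟩
      rw [List.filter_eq_self]
      simpa using hl
    · rintro ⟨h1, h2⟩
      rw [← h2, eq_comm, List.filter_eq_self]
      simpa using h1
  | a :: k, [], w, hk, _ => by
    simp only [interleavings, List.mem_singleton, List.filter_eq_nil_iff]
    constructor
    · rintro rfl
      refine ⟨?_, fun a ha => by simpa using hk a ha⟩
      rw [List.filter_eq_self]
      simpa using hk
    · rintro ⟨h1, h2⟩
      rw [← h1, eq_comm, List.filter_eq_self]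
      simpa using h2
  | a :: k, b :: l, w, hk, hl => by
    have ha : a < m := hk a (by simp)
    have hb : m ≤ b := hl b (by simp)
    have h1 := fun w => mem_interleavings m k (b :: l) w (fun x hx => hk x (by simp [hx])) hl
    have h2 := fun w => mem_interleavings m (a :: k) l w hk (fun x hx => hl x (by simp [hx]))
    simp only [interleavings, List.mem_append, List.mem_map, h1, h2]
    constructor
    · rintro (⟨w, ⟨h, h'⟩, rfl⟩ | ⟨w, ⟨h, h'⟩, rfl⟩)
      · simp [ha, h, h', ha.not_ge]
      · simp [h, h', hb, hb.not_gt]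
    · rintro ⟨h, h'⟩
      cases w with
      | nil => simp at h
      | cons c w =>
        rcases lt_or_ge c m with hc | hc
        · simp [hc, hc.not_ge] at h h'
          exact Or.inl ⟨w, ⟨h.2, h'⟩, by rw [h.1]⟩
        · simp [hc, hc.not_gt] at h h'
          exact Or.inr ⟨w, ⟨h, h'.2⟩, by rw [h'.1]⟩
  termination_by k l => k.length + l.length

theorem nodup_interleavings (m : ℕ) : ∀ (k l : List ℕ), (∀ a ∈ k, a < m) → (∀ b ∈ l, m ≤ b) →
    (interleavings k l).Nodup
  | [], l, _, _ => by simp [interleavings]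
  | a :: k, [], _, _ => by simp [interleavings]
  | a :: k, b :: l, hk, hl => by
    have ha : a < m := hk a (by simp)
    have hb : m ≤ b := hl b (by simp)
    have h1 := nodup_interleavings m k (b :: l) (fun x hx => hk x (by simp [hx])) hl
    have h2 := nodup_interleavings m (a :: k) l hk (fun x hx => hl x (by simp [hx]))
    rw [interleavings, List.nodup_append]
    refine ⟨h1.map fun _ _ h => by simpa using h, h2.map fun _ _ h => by simpa using h, ?_⟩
    rintro x hx y hy rfl
    simp only [List.mem_map] at hx hy
    obtain ⟨w, -, rfl⟩ := hx
    obtain ⟨w', -, h⟩ := hy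
    simp only [List.cons.injEq] at h
    omega
  termination_by k l => k.length + l.length

theorem isShuffle_iff (m n : ℕ) (σ : Equiv.Perm (Fin (m + n))) :
    IsShuffle m n σ ↔
      (List.ofFn fun k => (σ k : ℕ)) ∈ interleavings (List.range m) (List.range' m n) := by
  rw [mem_interleavings m _ _ _ (by simp) (by simp +contextual)]
  have hnd : (List.ofFn fun k => (σ k : ℕ)).Nodup :=
    List.nodup_ofFn.2 fun i j h => σ.injective (Fin.ext h)
  have hmem : ∀ x, x ∈ (List.ofFn fun k => (σ k : ℕ)) ↔ x < m + n := by
    intro x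
    rw [List.mem_ofFn]
    constructor
    · rintro ⟨k, rfl⟩; exact (σ k).2
    · intro hx; exact ⟨σ.symm ⟨x, hx⟩, by simp⟩
  have p1 : ((List.ofFn fun k => (σ k : ℕ)).filter (· < m)).Perm (List.range m) := by
    rw [List.perm_ext_iff_of_nodup (hnd.filter _) List.nodup_range]
    intro x
    simp only [List.mem_filter, hmem, List.mem_range, decide_eq_true_eq]
    omega
  have p2 : ((List.ofFn fun k => (σ k : ℕ)).filter (m ≤ ·)).Perm (List.range' m n) := by
    rw [List.perm_ext_iff_of_nodup (hnd.filter _) List.nodup_range']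
    intro x
    simp only [List.mem_filter, hmem, List.mem_range'_1, decide_eq_true_eq]
    omega
  have q1 : (List.ofFn fun k => (σ k : ℕ)).filter (· < m) = List.range m ↔
      ((List.ofFn fun k => (σ k : ℕ)).filter (· < m)).Pairwise (· < ·) :=
    ⟨fun h => by rw [h]; exact List.pairwise_lt_range,
      fun h => p1.eq_of_pairwise (fun _ _ _ _ h h' => absurd h' (lt_asymm h)) h
        List.pairwise_lt_range⟩
  have q2 : (List.ofFn fun k => (σ k : ℕ)).filter (m ≤ ·) = List.range' m n ↔
      ((List.ofFn fun k => (σ k : ℕ)).filter (m ≤ ·)).Pairwise (· < ·) :=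
    ⟨fun h => by rw [h]; exact List.pairwise_lt_range',
      fun h => p2.eq_of_pairwise (fun _ _ _ _ h h' => absurd h' (lt_asymm h)) h
        List.pairwise_lt_range'⟩
  rw [q1, q2, List.pairwise_filter, List.pairwise_filter, List.pairwise_ofFn, List.pairwise_ofFn,
    IsShuffle]
  simp only [decide_eq_true_eq]
  refine and_congr ⟨fun h i j hij hi hj => ?_, fun h i j hij => ?_⟩
    ⟨fun h i j hij hi hj => ?_, fun h i j hij => ?_⟩
  · by_contra hlt
    have := h.monotone (a := ⟨σ j, hj⟩) (b := ⟨σ i, hi⟩) (by simpa using hlt)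
    have e1 : Fin.castAdd n ⟨σ j, hj⟩ = σ j := rfl
    have e2 : Fin.castAdd n ⟨σ i, hi⟩ = σ i := rfl
    simp only [e1, e2, Equiv.symm_apply_apply] at this
    exact absurd hij this.not_gt
  · by_contra hlt
    have hne : σ.symm (Fin.castAdd n j) ≠ σ.symm (Fin.castAdd n i) := by
      simpa using hij.ne'
    have := h (lt_of_le_of_ne (not_lt.1 hlt) hne) (by simp) (by simp)
    simp only [Equiv.apply_symm_apply, Fin.val_castAdd] at this
    exact absurd hij (by simpa using this.le)
  · by_contra hlt
    have hi' : (σ i : ℕ) - m < n := by have := (σ i).2; omega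
    have hj' : (σ j : ℕ) - m < n := by have := (σ j).2; omega
    have := h.monotone (a := ⟨σ j - m, hj'⟩) (b := ⟨σ i - m, hi'⟩)
      (Fin.mk_le_mk.2 (by omega))
    have e1 : Fin.natAdd m ⟨σ j - m, hj'⟩ = σ j := Fin.ext (by simp; omega)
    have e2 : Fin.natAdd m ⟨σ i - m, hi'⟩ = σ i := Fin.ext (by simp; omega)
    simp only [e1, e2, Equiv.symm_apply_apply] at this
    exact absurd hij this.not_gt
  · by_contra hlt
    have hne : σ.symm (Fin.natAdd m j) ≠ σ.symm (Fin.natAdd m i) := by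
      simpa using hij.ne'
    have := h (lt_of_le_of_ne (not_lt.1 hlt) hne) (by simp) (by simp)
    simp only [Equiv.apply_symm_apply, Fin.val_natAdd] at this
    have hij' : (i : ℕ) < j := hij
    omega

theorem sum_shuffles (m n : ℕ) {M : Type*} [AddCommMonoid M] (g : List ℕ → M) :
    ∑ σ ∈ shuffles m n, g (List.ofFn fun k => (σ k : ℕ)) =
      ((interleavings (List.range m) (List.range' m n)).map g).sum := by
  rw [← List.sum_toFinset _ (nodup_interleavings m _ _ (by simp) (by simp +contextual))]
  refine Finset.sum_nbij (fun σ => List.ofFn fun k => (σ k : ℕ)) ?_ ?_ ?_ fun _ _ => rfl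
  · intro σ hσ
    simp only [shuffles, Finset.mem_filter, Finset.mem_univ, true_and] at hσ
    rw [List.mem_toFinset, ← isShuffle_iff]
    exact hσ
  · intro σ _ τ _ h
    have h' := List.ofFn_injective h
    ext k
    exact congrFun h' k
  · intro w hw
    rw [List.coe_toFinset, Set.mem_ofPred_eq] at hw
    have hw' := hw
    rw [mem_interleavings m _ _ _ (by simp) (by simp +contextual)] at hw'
    have hp : w.Perm (List.range m ++ List.range' m n) := by
      rw [← hw'.1, ← hw'.2]
      have := List.filter_append_perm (· < m) w
      have e : (fun x => decide (m ≤ x)) = fun x : ℕ => !decide (x < m) := by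
        funext x; rw [← decide_not]; simp only [not_lt]
      rw [e]
      exact this.symm
    have hnd : w.Nodup := by
      rw [hp.nodup_iff, List.nodup_append]
      refine ⟨List.nodup_range, List.nodup_range', ?_⟩
      intro a ha b hb
      simp at ha hb
      omega
    have hlen : w.length = m + n := by simpa using hp.length_eq
    have hlt : ∀ x ∈ w, x < m + n := by
      intro x hx
      rw [hp.mem_iff] at hx
      simp at hx
      omega
    let f : Fin (m + n) → Fin (m + n) := fun k =>
      ⟨w[(k : ℕ)]'(by omega), hlt _ (List.getElem_mem _)⟩
    have hf : Function.Injective f := by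
      intro i j hij
      have := congrArg Fin.val hij
      exact Fin.ext ((hnd.getElem_inj_iff).1 this)
    let σ : Equiv.Perm (Fin (m + n)) := Equiv.ofBijective f (Finite.injective_iff_bijective.1 hf)
    have hσ : (List.ofFn fun k => (σ k : ℕ)) = w := by
      apply List.ext_getElem
      · simp [hlen]
      · intro i h1 h2
        simp [σ, f]
    refine ⟨σ, ?_, hσ⟩
    simp only [shuffles, Finset.coe_filter, Finset.mem_univ, true_and, Set.mem_ofPred_eq]
    rw [isShuffle_iff, hσ]
    exact hw

variable (C : Type u) [CommRing C] (wt : C) {A : Type v} [CommRing A] [Algebra C A]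

/-- The sum of the mixable shuffles with a given underlying list of letters. -/
def mixSum (x : ℕ → A) (m k : ℕ) (w : List ℕ) : Words C A :=
  ∑ T ∈ (admList m k w).powerset, wt ^ T.card • word C (contract T k (w.map x))

theorem mixSum_nil (x : ℕ → A) (m k : ℕ) : mixSum C wt x m k [] = emptyWord C A := by
  simp [mixSum, admList, contract, word]

theorem notMem_of_subset_admList {m k i : ℕ} {w : List ℕ} {T : Finset ℕ}
    (hT : T ∈ (admList m k w).powerset) (hi : i < k) : i ∉ T := fun h => by
  have := ((mem_admList m k w i).1 (Finset.mem_powerset.1 hT h)).1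
  omega

theorem mixSum_cons (x : ℕ → A) (m k a : ℕ) (w : List ℕ)
    (h : ∀ b ∈ w.head?, ¬ (a < m ∧ m ≤ b)) :
    mixSum C wt x m k (a :: w) = cons C (x a) (mixSum C wt x m (k + 1) w) := by
  have e : admList m k (a :: w) = admList m (k + 1) w := by
    cases w with
    | nil => rfl
    | cons b w => rw [admList, if_neg (h b (by simp))]
  rw [mixSum, mixSum, e, map_sum]
  refine Finset.sum_congr rfl fun T hT => ?_
  rw [List.map_cons, contract_of_notMem (notMem_of_subset_admList hT (by omega)), word, map_smul]

theorem mixSum_cons_cons (x : ℕ → A) (m k a b : ℕ) (w : List ℕ) (ha : a < m) (hb : m ≤ b) :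
    mixSum C wt x m k (a :: b :: w) =
      cons C (x a) (mixSum C wt x m (k + 1) (b :: w)) +
        wt • cons C (x a * x b) (mixSum C wt x m (k + 2) w) := by
  have e : admList m (k + 1) (b :: w) = admList m (k + 2) w := by
    cases w with
    | nil => rfl
    | cons c w => rw [admList, if_neg (by omega)]
  have hk : k ∉ admList m (k + 1) (b :: w) := fun h => by
    have := ((mem_admList _ _ _ _).1 h).1
    omega
  rw [mixSum, admList, if_pos ⟨ha, hb⟩, Finset.sum_powerset_insert hk]
  congr 1
  · rw [mixSum, map_sum]
    refine Finset.sum_congr rfl fun T hT => ?_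
    rw [List.map_cons, contract_of_notMem (notMem_of_subset_admList hT (by omega)), word, map_smul]
  · rw [mixSum, e, map_sum, Finset.smul_sum]
    refine Finset.sum_congr rfl fun T hT => ?_
    have h0 := notMem_of_subset_admList hT (show k < k + 2 by omega)
    have h1 := notMem_of_subset_admList hT (show k + 1 < k + 2 by omega)
    rw [Finset.card_insert_of_notMem h0, List.map_cons, List.map_cons, contract,
      if_pos (Finset.mem_insert_self _ _), contract_of_notMem (by simp [h1]), word, map_smul,
      contract_congr (S := insert k T) (T := T) (k + 1 + 1), pow_succ', mul_smul]
    intro i hi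
    rw [Finset.mem_insert]
    exact or_iff_right (by omega)

theorem mixSum_left (x : ℕ → A) (m : ℕ) : ∀ (k : ℕ) (w : List ℕ), (∀ a ∈ w, a < m) →
    mixSum C wt x m k w = word C (w.map x)
  | k, [], _ => by simp [mixSum_nil, word]
  | k, a :: w, h => by
    rw [mixSum_cons, mixSum_left x m (k + 1) w fun b hb => h b (by simp [hb]), List.map_cons, word]
    intro b hb
    have := h b (List.mem_cons_of_mem _ (List.mem_of_mem_head? hb))
    omega

theorem mixSum_right (x : ℕ → A) (m : ℕ) : ∀ (k : ℕ) (w : List ℕ), (∀ a ∈ w, m ≤ a) →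
    mixSum C wt x m k w = word C (w.map x)
  | k, [], _ => by simp [mixSum_nil, word]
  | k, a :: w, h => by
    rw [mixSum_cons, mixSum_right x m (k + 1) w fun b hb => h b (by simp [hb]), List.map_cons, word]
    intro b hb
    have := h a (by simp)
    omega

theorem sum_map_cons_left (x : ℕ → A) (m k a b : ℕ) (l l' : List ℕ) (ha : a < m) (hb : m ≤ b)
    (hl : ∀ a ∈ l, a < m) :
    (((interleavings l (b :: l')).map (a :: ·)).map (mixSum C wt x m k)).sum =
      cons C (x a) (((interleavings l (b :: l')).map (mixSum C wt x m (k + 1))).sum) +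
        wt • cons C (x a * x b) (((interleavings l l').map (mixSum C wt x m (k + 2))).sum) := by
  have key : ∀ L : List (List ℕ), ((L.map (a :: ·)).map (mixSum C wt x m k)).sum =
      (L.map fun w => mixSum C wt x m k (a :: w)).sum := fun L => by
    rw [List.map_map]; rfl
  have hB : ∀ L : List (List ℕ), (((L.map (b :: ·)).map (a :: ·)).map (mixSum C wt x m k)).sum =
      cons C (x a) (((L.map (b :: ·)).map (mixSum C wt x m (k + 1))).sum) +
        wt • cons C (x a * x b) ((L.map (mixSum C wt x m (k + 2))).sum) := fun L => by
    induction L with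
    | nil => simp
    | cons w L ih =>
      simp only [List.map_cons, List.sum_cons, map_add, ih, smul_add,
        mixSum_cons_cons C wt x m k a b w ha hb]
      abel
  have hA : ∀ (a' : ℕ) (_ : a' < m) (L : List (List ℕ)),
      (((L.map (a' :: ·)).map (a :: ·)).map (mixSum C wt x m k)).sum =
      cons C (x a) (((L.map (a' :: ·)).map (mixSum C wt x m (k + 1))).sum) := fun a' h L => by
    induction L with
    | nil => simp
    | cons w L ih =>
      simp only [List.map_cons, List.sum_cons, map_add, ih]
      rw [mixSum_cons C wt x m k a (a' :: w) (by simp; omega)]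
  cases l with
  | nil => simpa [interleavings] using hB [l']
  | cons a' l =>
    have ha' : a' < m := hl a' (by simp)
    rw [interleavings, List.map_append, List.map_append, List.map_append, List.sum_append,
      List.sum_append, hA a' ha', hB, map_add, add_assoc]

theorem sum_interleavings (x : ℕ → A) (m : ℕ) : ∀ (k : ℕ) (l l' : List ℕ), (∀ a ∈ l, a < m) →
    (∀ b ∈ l', m ≤ b) → ((interleavings l l').map (mixSum C wt x m k)).sum =
      shuffle C A wt (word C (l.map x)) (word C (l'.map x))
  | k, [], l', _, hl' => by
    simp [interleavings, word, emptyWord_shuffle, mixSum_right C wt x m k l' hl']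
  | k, a :: l, [], hl, _ => by
    rw [List.map_nil, word.eq_1 C, shuffle_emptyWord]
    simp [interleavings, mixSum_left C wt x m k (a :: l) hl]
  | k, a :: l, b :: l', hl, hl' => by
    have ha : a < m := hl a (by simp)
    have hb : m ≤ b := hl' b (by simp)
    have hl1 : ∀ a ∈ l, a < m := fun c hc => hl c (by simp [hc])
    have hl2 : ∀ a ∈ l', m ≤ a := fun c hc => hl' c (by simp [hc])
    have h1 := sum_interleavings x m (k + 1) l (b :: l') hl1 hl'
    have h2 := sum_interleavings x m (k + 1) (a :: l) l' hl hl2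
    have h3 := sum_interleavings x m (k + 2) l l' hl1 hl2
    have hB : ∀ L : List (List ℕ), ((L.map (b :: ·)).map (mixSum C wt x m k)).sum =
        cons C (x b) ((L.map (mixSum C wt x m (k + 1))).sum) := fun L => by
      induction L with
      | nil => simp
      | cons w L ih =>
        simp only [List.map_cons, List.sum_cons, map_add, ih]
        rw [mixSum_cons C wt x m k b w (by intros; omega)]
    rw [interleavings, List.map_append, List.sum_append,
      sum_map_cons_left C wt x m k a b l l' ha hb hl1, hB, h1, h2, h3]
    simp only [List.map_cons, word, cons_shuffle_cons]
    abel
  termination_by k l l' => l.length + l'.length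

theorem admList_ofFn (m n : ℕ) (σ : Equiv.Perm (Fin (m + n))) :
    admList m 0 (List.ofFn fun k => (σ k : ℕ)) = admissible m n σ := by
  ext i
  simp only [mem_admList, admissible, Finset.mem_filter, Finset.mem_range, Nat.sub_zero,
    List.length_ofFn, List.getElem_ofFn, Nat.zero_le, true_and]
  constructor
  · rintro ⟨h, h'⟩
    exact ⟨by omega, h, h'⟩
  · rintro ⟨-, h, h'⟩
    exact ⟨h, h'⟩

/-- The product of words is the sum over all mixable shuffles `(σ, T)`. -/
theorem shuffle_word_ofFn (m n : ℕ) (x : Fin m → A) (y : Fin n → A) :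
    shuffle C A wt (word C (List.ofFn x)) (word C (List.ofFn y)) =
      ∑ σ ∈ shuffles m n, ∑ T ∈ (admissible m n σ).powerset,
        wt ^ T.card • word C (contract T 0 (List.ofFn fun k => Fin.append x y (σ k))) := by
  let z : ℕ → A := fun k => if h : k < m + n then Fin.append x y ⟨k, h⟩ else 0
  have hx : (List.range m).map z = List.ofFn x := by
    apply List.ext_getElem
    · simp
    · intro i h1 h2
      have hi : i < m := by simpa using h1
      have : Fin.append x y ⟨i, by omega⟩ = x ⟨i, hi⟩ := Fin.append_left x y ⟨i, hi⟩
      simp [z, this, show i < m + n by omega]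
  have hy : (List.range' m n).map z = List.ofFn y := by
    apply List.ext_getElem
    · simp
    · intro i h1 h2
      have hi : i < n := by simpa using h1
      have : Fin.append x y ⟨m + i, by omega⟩ = y ⟨i, hi⟩ := Fin.append_right x y ⟨i, hi⟩
      simp [z, this, hi]
  rw [← hx, ← hy, ← sum_interleavings C wt z m 0 _ _ (by simp) (by simp +contextual), ← sum_shuffles]
  refine Finset.sum_congr rfl fun σ _ => ?_
  rw [mixSum, admList_ofFn]
  refine Finset.sum_congr rfl fun T _ => ?_
  rw [List.map_ofFn]
  congr 3
  refine congrArg List.ofFn (funext fun k => ?_)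
  simp [z]

end MixableShuffles

section ShaAlgebra

variable (C : Type u) [CommRing C] (wt : C) (A : Type v) [CommRing A] [Algebra C A]

/-- The underlying module `⨁_{k ≥ 0} A^{⊗ (k+1)}` of the shuffle Baxter algebra on `A` of
weight `wt`. -/
def Sha (_wt : C) (A : Type v) [CommRing A] [Algebra C A] : Type (max u v) :=
  ⨁ k : ℕ, ⨂[C]^(k + 1) A

namespace Sha

instance : AddCommGroup (Sha C wt A) :=
  inferInstanceAs (AddCommGroup (⨁ k : ℕ, ⨂[C]^(k + 1) A))

instance : Module C (Sha C wt A) :=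
  inferInstanceAs (Module C (⨁ k : ℕ, ⨂[C]^(k + 1) A))

/-- The inclusion of the summand `A^{⊗ (k+1)}`. -/
def incl (k : ℕ) : (⨂[C]^(k + 1) A) →ₗ[C] Sha C wt A :=
  DirectSum.lof C ℕ (fun k => ⨂[C]^(k + 1) A) k

variable {C wt A} in
theorem hom_ext {M : Type*} [AddCommGroup M] [Module C M] {f g : Sha C wt A →ₗ[C] M}
    (h : ∀ k, f ∘ₗ incl C wt A k = g ∘ₗ incl C wt A k) : f = g :=
  DirectSum.linearMap_ext (R := C) (M := fun k => ⨂[C]^(k + 1) A) h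

/-- The linear map out of the direct sum with given components. -/
def desc {M : Type*} [AddCommGroup M] [Module C M] (f : ∀ k, (⨂[C]^(k + 1) A) →ₗ[C] M) :
    Sha C wt A →ₗ[C] M :=
  DirectSum.toModule C ℕ M f

@[simp]
theorem desc_incl {M : Type*} [AddCommGroup M] [Module C M]
    (f : ∀ k, (⨂[C]^(k + 1) A) →ₗ[C] M) (k : ℕ) (x : ⨂[C]^(k + 1) A) :
    desc C wt A f (incl C wt A k x) = f k x :=
  DirectSum.toModule_lof (R := C) (M := fun k => ⨂[C]^(k + 1) A) (φ := f) k x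

/-- The bilinear map `(x₀, x⁺) ↦ x₀ ⊗ x⁺`. -/
def mk : A →ₗ[C] Words C A →ₗ[C] Sha C wt A :=
  LinearMap.flip (DirectSum.toModule C ℕ _ fun k =>
    ((consPow C k).compr₂ (incl C wt A k)).flip)

theorem mk_lof (a : A) (k : ℕ) (w : ⨂[C]^k A) :
    mk C wt A a (DirectSum.lof C ℕ (fun k => ⨂[C]^k A) k w) = incl C wt A k (consPow C k a w) := by
  simp [mk]

theorem incl_tprod (k : ℕ) (x : Fin (k + 1) → A) :
    incl C wt A k (PiTensorProduct.tprod C x) =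
      mk C wt A (x 0) (word C (List.ofFn (Fin.tail x))) := by
  rw [word_ofFn, mk_lof, tprod_succ]

/-- The identification `A ⊗ ⨁_k A^{⊗ k} ≅ ⨁_k A^{⊗ (k+1)}`. -/
def split : Sha C wt A ≃ₗ[C] A ⊗[C] Words C A :=
  LinearEquiv.ofLinearMap
    (desc C wt A fun k => uncons C k
      ((TensorProduct.mk C A (Words C A)).compl₂ (DirectSum.lof C ℕ (fun k => ⨂[C]^k A) k)))
    (TensorProduct.lift (mk C wt A))
    (by
      apply TensorProduct.ext
      apply LinearMap.ext
      intro a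
      apply DirectSum.linearMap_ext
      intro k
      apply LinearMap.ext
      intro w
      simp [mk_lof, uncons_consPow])
    (by
      apply hom_ext
      intro k
      apply PiTensorProduct.ext
      ext x
      simp only [LinearMap.compMultilinearMap_apply, LinearMap.comp_apply, desc_incl, tprod_succ,
        uncons_consPow, LinearMap.compl₂_apply, TensorProduct.mk_apply, TensorProduct.lift.tmul,
        mk_lof, LinearMap.id_apply])

@[simp]
theorem split_symm_tmul (a : A) (w : Words C A) :
    (split C wt A).symm (a ⊗ₜ w) = mk C wt A a w := by
  simp [split]

@[simp]
theorem split_mk (a : A) (w : Words C A) : split C wt A (mk C wt A a w) = a ⊗ₜ w := by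
  rw [← split_symm_tmul, LinearEquiv.apply_symm_apply]

variable {C wt A} in
theorem induction {p : Sha C wt A → Prop} (x : Sha C wt A) (hmk : ∀ a w, p (mk C wt A a w))
    (hadd : ∀ x y, p x → p y → p (x + y)) : p x := by
  obtain ⟨t, rfl⟩ := (split C wt A).symm.surjective x
  induction t using TensorProduct.induction_on with
  | zero => simpa using hmk 0 0
  | tmul a w => simpa using hmk a w
  | add s t hs ht => rw [map_add]; exact hadd _ _ hs ht

/-- The mixable shuffle product, as a bilinear map: the product of `x₀ ⊗ x⁺` and `y₀ ⊗ y⁺` is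
`x₀ y₀ ⊗ (x⁺ ⧢ y⁺)`. -/
def mulHom : Sha C wt A →ₗ[C] Sha C wt A →ₗ[C] Sha C wt A :=
  ((TensorProduct.map₂ (LinearMap.mul C A) (shuffle C A wt)).compl₁₂ (split C wt A).toLinearMap
    (split C wt A).toLinearMap).compr₂ (split C wt A).symm.toLinearMap

instance : Mul (Sha C wt A) := ⟨fun x y => mulHom C wt A x y⟩

instance : One (Sha C wt A) := ⟨mk C wt A 1 (emptyWord C A)⟩

theorem one_def : (1 : Sha C wt A) = mk C wt A 1 (emptyWord C A) := rfl

theorem mul_def (x y : Sha C wt A) : x * y = mulHom C wt A x y := rfl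

theorem mk_mul_mk (a b : A) (u v : Words C A) :
    mk C wt A a u * mk C wt A b v = mk C wt A (a * b) (shuffle C A wt u v) := by
  simp [mul_def, mulHom]

/-- The pure tensor `a ⊗ l₁ ⊗ ⋯ ⊗ lₖ`, in the summand `A^{⊗ (k+1)}`. -/
def pure (a : A) (l : List A) : Sha C wt A :=
  incl C wt A l.length (PiTensorProduct.tprod C (Fin.cons a l.get : Fin (l.length + 1) → A))

theorem pure_eq_mk (a : A) (l : List A) : pure C wt A a l = mk C wt A a (word C l) := by
  rw [pure, incl_tprod, Fin.tail_cons, Fin.cons_zero, List.ofFn_get]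

/-- The product of pure tensors is
`∑ wt^{|T|} x₀ y₀ ⊗ σ(x⁺ ⊗ y⁺; T)`, summed over all mixable shuffles `(σ, T)`. -/
theorem incl_mul_incl (m n : ℕ) (x : Fin (m + 1) → A) (y : Fin (n + 1) → A) :
    incl C wt A m (PiTensorProduct.tprod C x) * incl C wt A n (PiTensorProduct.tprod C y) =
      ∑ σ ∈ shuffles m n, ∑ T ∈ (admissible m n σ).powerset,
        wt ^ T.card • pure C wt A (x 0 * y 0)
          (contract T 0 (List.ofFn fun k => Fin.append (Fin.tail x) (Fin.tail y) (σ k))) := by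
  rw [incl_tprod, incl_tprod, mk_mul_mk, shuffle_word_ofFn]
  simp only [map_sum, map_smul, pure_eq_mk]

theorem mul_comm' (x y : Sha C wt A) : x * y = y * x := by
  induction x using induction with
  | hmk a u =>
    induction y using induction with
    | hmk b v => rw [mk_mul_mk, mk_mul_mk, mul_comm, shuffle_comm]
    | hadd x y hx hy => simp only [mul_def, map_add, LinearMap.add_apply] at *; rw [hx, hy]
  | hadd x y hx hy => simp only [mul_def, map_add, LinearMap.add_apply] at *; rw [hx, hy]

theorem mul_assoc' (x y z : Sha C wt A) : x * y * z = x * (y * z) := by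
  induction x using induction with
  | hmk a u =>
    induction y using induction with
    | hmk b v =>
      induction z using induction with
      | hmk c w => simp only [mk_mul_mk, mul_assoc, shuffle_assoc]
      | hadd x y hx hy => simp only [mul_def, map_add, LinearMap.add_apply] at *; rw [hx, hy]
    | hadd x y hx hy => simp only [mul_def, map_add, LinearMap.add_apply] at *; rw [hx, hy]
  | hadd x y hx hy => simp only [mul_def, map_add, LinearMap.add_apply] at *; rw [hx, hy]

theorem one_mul' (x : Sha C wt A) : 1 * x = x := by
  induction x using induction with
  | hmk a u => rw [one_def, mk_mul_mk, one_mul, emptyWord_shuffle]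
  | hadd x y hx hy => simp only [mul_def, map_add] at *; rw [hx, hy]

instance : CommRing (Sha C wt A) :=
  { (inferInstance : AddCommGroup (Sha C wt A)) with
    mul := (· * ·)
    one := 1
    mul_assoc := mul_assoc' C wt A
    mul_comm := mul_comm' C wt A
    one_mul := one_mul' C wt A
    mul_one := fun x => by rw [mul_comm', one_mul']
    left_distrib := fun x y z => by simp only [mul_def, map_add]
    right_distrib := fun x y z => by simp only [mul_def, map_add, LinearMap.add_apply]
    zero_mul := fun x => by simp only [mul_def, map_zero, LinearMap.zero_apply]
    mul_zero := fun x => by simp only [mul_def, map_zero] }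

instance : Algebra C (Sha C wt A) :=
  Algebra.ofModule (fun c x y => by simp only [mul_def, map_smul, LinearMap.smul_apply])
    (fun c x y => by simp only [mul_def, map_smul])

/-- The Baxter operator `x₀ ⊗ ⋯ ⊗ xₖ ↦ 1 ⊗ x₀ ⊗ ⋯ ⊗ xₖ`. -/
def op : Sha C wt A →ₗ[C] Sha C wt A :=
  desc C wt A fun k => incl C wt A (k + 1) ∘ₗ consPow C (k + 1) 1

theorem op_mk (a : A) (w : Words C A) : op C wt A (mk C wt A a w) = mk C wt A 1 (cons C a w) := by
  suffices h : op C wt A ∘ₗ mk C wt A a = mk C wt A 1 ∘ₗ cons C a from LinearMap.congr_fun h w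
  apply DirectSum.linearMap_ext
  intro k
  apply LinearMap.ext
  intro w
  simp [op, mk_lof, cons_lof]

theorem op_mul_op (x y : Sha C wt A) :
    op C wt A x * op C wt A y =
      op C wt A (x * op C wt A y) + op C wt A (y * op C wt A x) + wt • op C wt A (x * y) := by
  induction x using induction with
  | hmk a u =>
    induction y using induction with
    | hmk b v =>
      simp only [op_mk, mk_mul_mk, mul_one, cons_shuffle_cons, map_add, map_smul]
      rw [shuffle_comm C wt v]
    | hadd x y hx hy =>
      simp only [map_add, mul_add, add_mul, hx, hy, smul_add]
      abel
  | hadd x y hx hy =>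
    simp only [map_add, mul_add, add_mul, hx, hy, smul_add]
    abel

variable {A} {B : Type v} [CommRing B] [Algebra C B]

/-- The linear map `⨁_k f^{⊗ (k+1)}`. -/
def mapLinear (f : A →ₐ[C] B) : Sha C wt A →ₗ[C] Sha C wt B :=
  desc C wt A fun k => incl C wt B k ∘ₗ PiTensorProduct.map fun _ => f.toLinearMap

theorem mapLinear_incl (f : A →ₐ[C] B) (k : ℕ) (x : Fin (k + 1) → A) :
    mapLinear C wt f (incl C wt A k (PiTensorProduct.tprod C x)) =
      incl C wt B k (PiTensorProduct.tprod C fun i => f (x i)) := by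
  simp [mapLinear]

/-- `f` applied to every letter of a word. -/
def wordsMap (f : A →ₐ[C] B) : Words C A →ₗ[C] Words C B :=
  DirectSum.lmap fun _ => PiTensorProduct.map fun _ => f.toLinearMap

theorem wordsMap_word (f : A →ₐ[C] B) (l : List A) :
    wordsMap C f (word C l) = word C (l.map f) := by
  obtain ⟨n, x, rfl⟩ : ∃ (n : ℕ) (x : Fin n → A), List.ofFn x = l :=
    ⟨l.length, l.get, List.ofFn_get l⟩
  rw [List.map_ofFn, word_ofFn, word_ofFn, wordsMap, DirectSum.lmap_lof, PiTensorProduct.map_tprod]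
  rfl

theorem wordsMap_cons (f : A →ₐ[C] B) (a : A) (w : Words C A) :
    wordsMap C f (cons C a w) = cons C (f a) (wordsMap C f w) := by
  suffices h : wordsMap C f ∘ₗ cons C a = cons C (f a) ∘ₗ wordsMap C f from
    LinearMap.congr_fun h w
  apply words_hom_ext
  intro l
  have := wordsMap_word C f (a :: l)
  simpa only [LinearMap.comp_apply, wordsMap_word, List.map_cons, word] using this

theorem mapLinear_mk (f : A →ₐ[C] B) (a : A) (w : Words C A) :
    mapLinear C wt f (mk C wt A a w) = mk C wt B (f a) (wordsMap C f w) := by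
  suffices h : mapLinear C wt f ∘ₗ mk C wt A a = mk C wt B (f a) ∘ₗ wordsMap C f from
    LinearMap.congr_fun h w
  apply words_hom_ext
  intro l
  obtain ⟨n, x, rfl⟩ : ∃ (n : ℕ) (x : Fin n → A), List.ofFn x = l :=
    ⟨l.length, l.get, List.ofFn_get l⟩
  have := mapLinear_incl C wt f n (Fin.cons a x)
  simp only [incl_tprod, Fin.tail_cons, Fin.cons_zero] at this
  simp only [LinearMap.comp_apply, wordsMap_word, List.map_ofFn]
  rw [this]
  rfl

theorem wordsMap_shuffle_word (f : A →ₐ[C] B) : ∀ k l : List A,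
    wordsMap C f (shuffle C A wt (word C k) (word C l)) =
      shuffle C B wt (word C (k.map f)) (word C (l.map f))
  | [], l => by rw [List.map_nil, word, word, emptyWord_shuffle, emptyWord_shuffle, wordsMap_word]
  | _ :: _, [] => by
    rw [List.map_nil, word.eq_1 C, word.eq_1 C, shuffle_emptyWord, shuffle_emptyWord, wordsMap_word]
  | a :: k, b :: l => by
    have h1 := wordsMap_shuffle_word f k (b :: l)
    have h2 := wordsMap_shuffle_word f (a :: k) l
    have h3 := wordsMap_shuffle_word f k l
    simp only [List.map_cons, word] at h1 h2 ⊢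
    simp only [cons_shuffle_cons, map_add, map_smul, wordsMap_cons, h1, h2, h3, map_mul]
  termination_by k l => k.length + l.length

theorem wordsMap_shuffle (f : A →ₐ[C] B) (u v : Words C A) :
    wordsMap C f (shuffle C A wt u v) = shuffle C B wt (wordsMap C f u) (wordsMap C f v) := by
  induction u using words_induction with
  | hw k =>
    induction v using words_induction with
    | hw l => rw [wordsMap_shuffle_word, wordsMap_word, wordsMap_word]
    | hadd u v hu hv => simp only [map_add, hu, hv]
    | hsmul c u hu => simp only [map_smul, hu]
  | hadd u v hu hv => simp only [map_add, LinearMap.add_apply, hu, hv]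
  | hsmul c u hu => simp only [map_smul, LinearMap.smul_apply, hu]

/-- The algebra homomorphism `⨁_k f^{⊗ (k+1)}` induced by `f`. -/
def map (f : A →ₐ[C] B) : Sha C wt A →ₐ[C] Sha C wt B :=
  AlgHom.ofLinearMap (mapLinear C wt f)
    (by
      have h := wordsMap_word C f []
      rw [List.map_nil, word, word] at h
      rw [one_def, one_def, mapLinear_mk, map_one, h])
    (fun x y => by
      induction x using induction with
      | hmk a u =>
        induction y using induction with
        | hmk b v => simp only [mk_mul_mk, mapLinear_mk, map_mul, wordsMap_shuffle]
        | hadd x y hx hy => simp only [mul_add, map_add, hx, hy]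
      | hadd x y hx hy => simp only [add_mul, map_add, hx, hy])

theorem map_apply (f : A →ₐ[C] B) (x : Sha C wt A) : map C wt f x = mapLinear C wt f x := rfl

theorem map_incl (f : A →ₐ[C] B) (k : ℕ) (x : Fin (k + 1) → A) :
    map C wt f (incl C wt A k (PiTensorProduct.tprod C x)) =
      incl C wt B k (PiTensorProduct.tprod C fun i => f (x i)) :=
  mapLinear_incl C wt f k x

theorem map_op (f : A →ₐ[C] B) (x : Sha C wt A) :
    map C wt f (op C wt A x) = op C wt B (map C wt f x) := by
  induction x using induction with
  | hmk a w => simp only [map_apply, op_mk, mapLinear_mk, map_one, wordsMap_cons]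
  | hadd x y hx hy => simp only [map_add, hx, hy]

variable {C wt} in
theorem algHom_ext {R : Type*} [CommRing R] [Algebra C R] {f g : Sha C wt A →ₐ[C] R}
    (h : ∀ (k : ℕ) (x : Fin (k + 1) → A),
      f (incl C wt A k (PiTensorProduct.tprod C x)) =
        g (incl C wt A k (PiTensorProduct.tprod C x))) : f = g := by
  apply AlgHom.toLinearMap_injective
  apply hom_ext
  intro k
  apply PiTensorProduct.ext
  ext x
  exact h k x

theorem map_id : map C wt (AlgHom.id C A) = AlgHom.id C (Sha C wt A) :=
  algHom_ext fun k x => map_incl C wt (AlgHom.id C A) k x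

theorem map_comp {D : Type v} [CommRing D] [Algebra C D] (g : B →ₐ[C] D) (f : A →ₐ[C] B) :
    map C wt (g.comp f) = (map C wt g).comp (map C wt f) :=
  algHom_ext fun k x => by
    rw [AlgHom.comp_apply, map_incl, map_incl, map_incl]
    rfl

/-- The Baxter operator on pure tensors. -/
theorem op_incl (k : ℕ) (x : Fin (k + 1) → A) :
    op C wt A (incl C wt A k (PiTensorProduct.tprod C x)) =
      incl C wt A (k + 1) (PiTensorProduct.tprod C (Fin.cons 1 x : Fin (k + 2) → A)) := by
  rw [op, desc_incl, LinearMap.comp_apply, consPow_tprod]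

end Sha
end ShaAlgebra

/-- A Baxter `C`-algebra of weight `wt`: a commutative `C`-algebra with a `C`-linear Baxter
operator of weight `wt`. -/
structure BaxCat (C : Type u) [CommRing C] (wt : C) where
  /-- The underlying type. -/
  carrier : Type v
  [commRing : CommRing carrier]
  [algebra : Algebra C carrier]
  /-- The Baxter operator. -/
  op : carrier →ₗ[C] carrier
  op_mul_op : ∀ x y, op x * op y = op (x * op y) + op (y * op x) + wt • op (x * y)

namespace BaxCat

attribute [instance] commRing algebra

variable {C : Type u} [CommRing C] {wt : C}

/-- Homomorphisms of Baxter algebras. -/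
@[ext]
structure Hom (R S : BaxCat.{u, v} C wt) where
  /-- The underlying algebra homomorphism. -/
  alg : R.carrier →ₐ[C] S.carrier
  map_op : ∀ x, alg (R.op x) = S.op (alg x)

/-- The category of Baxter `C`-algebras of weight `wt`. -/
instance : Category (BaxCat.{u, v} C wt) where
  Hom := Hom
  id R := ⟨AlgHom.id C R.carrier, fun _ => rfl⟩
  comp f g := ⟨g.alg.comp f.alg, fun x => by simp [f.map_op, g.map_op]⟩

@[ext]
theorem hom_ext {R S : BaxCat.{u, v} C wt} {f g : R ⟶ S} (h : f.alg = g.alg) : f = g :=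
  Hom.ext h

end BaxCat

/-- The shuffle Baxter algebra functor `A ↦ (Sha A, op)`, `f ↦ ⨁_k f^{⊗ (k+1)}`. -/
def shaFunctor (C : Type u) [CommRing C] (wt : C) : CommAlgCat.{u} C ⥤ BaxCat.{u, u} C wt where
  obj A := { carrier := Sha C wt A, op := Sha.op C wt A, op_mul_op := Sha.op_mul_op C wt A }
  map f := { alg := Sha.map C wt f.hom, map_op := Sha.map_op C wt f.hom }
  map_id A := BaxCat.hom_ext (Sha.map_id C wt)
  map_comp f g := BaxCat.hom_ext (Sha.map_comp C wt g.hom f.hom)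

end Baxter

end

/-!
The theorem holds because `Sha C wt A` is the free Baxter algebra on `A`: the functor `shaFunctor`
is left adjoint to forgetting the operator, so it preserves colimits. Let `(R, P)` be a Baxter
algebra. The only possible extension of `f : A →ₐ[C] R` sends `x₀ ⊗ x₁ ⊗ ⋯ ⊗ xₖ` to
`f x₀ * P (f x₁ * P (f x₂ * ⋯ P (f xₖ)))`, because
`x₀ ⊗ x₁ ⊗ ⋯ ⊗ xₖ = x₀ * op (x₁ ⊗ ⋯ ⊗ xₖ)`. That this formula is multiplicative follows by
induction on words: the recursion for the mixable shuffle product, according to the first letter of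
the result, is exactly the Baxter identity.
-/

universe w w'

noncomputable section

namespace Baxter

section Words

variable {C : Type u} [CommRing C] {A : Type v} [CommRing A] [Algebra C A]
  {M : Type*} [AddCommGroup M] [Module C M]

theorem words_hom_ext₂ {f g : Words C A →ₗ[C] Words C A →ₗ[C] M}
    (h : ∀ k l, f (word C k) (word C l) = g (word C k) (word C l)) : f = g :=
  words_hom_ext C fun k => words_hom_ext C (h k)

/-- The component of `wordsFoldr` on words of length `n`. -/
def foldrPow (s : A →ₗ[C] M →ₗ[C] M) (z : M) : (n : ℕ) → (⨂[C]^n A) →ₗ[C] M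
  | 0 => LinearMap.toSpanSingleton C M z ∘ₗ
      (PiTensorProduct.isEmptyEquiv (R := C) (s := fun _ : Fin 0 => A) (Fin 0)).toLinearMap
  | n + 1 => uncons C n (s.compl₂ (foldrPow s z n))

/-- The right fold `a₁ ⊗ ⋯ ⊗ aₙ ↦ s a₁ (s a₂ (⋯ (s aₙ z)))` of a bilinear map over words. -/
def wordsFoldr (s : A →ₗ[C] M →ₗ[C] M) (z : M) : Words C A →ₗ[C] M :=
  DirectSum.toModule C ℕ M (foldrPow s z)

theorem wordsFoldr_emptyWord (s : A →ₗ[C] M →ₗ[C] M) (z : M) :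
    wordsFoldr s z (emptyWord C A) = z := by
  simp [wordsFoldr, emptyWord, foldrPow]

theorem wordsFoldr_cons (s : A →ₗ[C] M →ₗ[C] M) (z : M) (a : A) (w : Words C A) :
    wordsFoldr s z (cons C a w) = s a (wordsFoldr s z w) := by
  suffices h : wordsFoldr s z ∘ₗ cons C a = s a ∘ₗ wordsFoldr s z from LinearMap.congr_fun h w
  refine DirectSum.linearMap_ext C fun n => LinearMap.ext fun w => ?_
  simp [cons_lof, wordsFoldr, foldrPow, uncons_consPow]

theorem wordsMap_emptyWord {B : Type v} [CommRing B] [Algebra C B] (f : A →ₐ[C] B) :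
    Sha.wordsMap C f (emptyWord C A) = emptyWord C B := by
  simpa only [List.map_nil, word] using Sha.wordsMap_word C f []

end Words

section BaxterOperator

variable {C : Type u} [CommRing C] {wt : C} {A : Type v} [CommRing A] [Algebra C A]
  {R : Type*} [CommRing R] [Algebra C R]

/-- `P` is a Baxter operator of weight `wt` on `R`: the identity required of the operator of an
object of `BaxCat`, for an algebra `R` in any universe. -/
def IsBaxterOperator (wt : C) (P : R →ₗ[C] R) : Prop :=
  ∀ x y, P x * P y = P (x * P y) + P (y * P x) + wt • P (x * y)

/-- The iterated operator `a₁ ⊗ ⋯ ⊗ aₙ ↦ P (f a₁ * P (f a₂ * ⋯ P (f aₙ)))`, through which the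
extension of `f` to the shuffle Baxter algebra is defined. -/
def evalWords (P : R →ₗ[C] R) (f : A →ₗ[C] R) : Words C A →ₗ[C] R :=
  wordsFoldr ((LinearMap.mul C R ∘ₗ f).compr₂ P) 1

theorem evalWords_emptyWord (P : R →ₗ[C] R) (f : A →ₗ[C] R) :
    evalWords P f (emptyWord C A) = 1 :=
  wordsFoldr_emptyWord _ _

theorem evalWords_cons (P : R →ₗ[C] R) (f : A →ₗ[C] R) (a : A) (w : Words C A) :
    evalWords P f (cons C a w) = P (f a * evalWords P f w) :=
  wordsFoldr_cons _ _ a w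

theorem evalWords_cons_shuffle_cons (P : R →ₗ[C] R) (f : A →ₐ[C] R) (a b : A) (u v : Words C A) :
    evalWords P f.toLinearMap (shuffle C A wt (cons C a u) (cons C b v)) =
      P (f a * evalWords P f.toLinearMap (shuffle C A wt u (cons C b v))) +
        P (f b * evalWords P f.toLinearMap (shuffle C A wt (cons C a u) v)) +
        wt • P (f a * f b * evalWords P f.toLinearMap (shuffle C A wt u v)) := by
  simp only [cons_shuffle_cons, map_add, map_smul, evalWords_cons, AlgHom.toLinearMap_apply,
    map_mul]

namespace IsBaxterOperator

variable {P : R →ₗ[C] R} (hP : IsBaxterOperator wt P)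
include hP

theorem evalWords_shuffle_word (f : A →ₐ[C] R) (k l : List A) :
    evalWords P f.toLinearMap (shuffle C A wt (word C k) (word C l)) =
      evalWords P f.toLinearMap (word C k) * evalWords P f.toLinearMap (word C l) := by
  induction k generalizing l with
  | nil => rw [word, emptyWord_shuffle, evalWords_emptyWord, one_mul]
  | cons a k ihk =>
    induction l with
    | nil => simp only [word, shuffle_emptyWord, evalWords_emptyWord, mul_one]
    | cons b l ihl =>
      have ihk_cons := ihk (b :: l)
      simp only [word] at ihk_cons ihl ⊢
      rw [evalWords_cons_shuffle_cons, ihk_cons, ihl, ihk]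
      simp only [evalWords_cons, AlgHom.toLinearMap_apply]
      rw [hP]
      congr 3 <;> ring

theorem evalWords_shuffle (f : A →ₐ[C] R) (u v : Words C A) :
    evalWords P f.toLinearMap (shuffle C A wt u v) =
      evalWords P f.toLinearMap u * evalWords P f.toLinearMap v := by
  have h : (shuffle C A wt).compr₂ (evalWords P f.toLinearMap) =
      (LinearMap.mul C R).compl₁₂ (evalWords P f.toLinearMap) (evalWords P f.toLinearMap) :=
    words_hom_ext₂ (hP.evalWords_shuffle_word f)
  exact LinearMap.congr_fun₂ h u v

end IsBaxterOperator

end BaxterOperator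

namespace Sha

variable {C : Type u} [CommRing C] {wt : C} {A : Type v} [CommRing A] [Algebra C A]

/-- The linear map `a ⊗ w ↦ b a w` on the shuffle Baxter algebra, for a bilinear map `b` of a
letter and a word. -/
def descMk (wt : C) {M : Type*} [AddCommGroup M] [Module C M]
    (b : A →ₗ[C] Words C A →ₗ[C] M) : Sha C wt A →ₗ[C] M :=
  TensorProduct.lift b ∘ₗ (split C wt A).toLinearMap

theorem descMk_mk {M : Type*} [AddCommGroup M] [Module C M] (b : A →ₗ[C] Words C A →ₗ[C] M)
    (a : A) (w : Words C A) : descMk wt b (mk C wt A a w) = b a w := by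
  simp [descMk]

variable (C wt A) in
/-- The inclusion of `A` as the tensors with a single factor: the unit of the adjunction between
`shaFunctor` and `BaxCat.forgetOp`. -/
def ι : A →ₐ[C] Sha C wt A :=
  AlgHom.ofLinearMap ((mk C wt A).flip (emptyWord C A)) rfl fun a b => by
    simp only [LinearMap.flip_apply, mk_mul_mk, emptyWord_shuffle]

theorem ι_apply (a : A) : ι C wt A a = mk C wt A a (emptyWord C A) := rfl

theorem ι_mul_mk (a b : A) (w : Words C A) :
    ι C wt A a * mk C wt A b w = mk C wt A (a * b) w := by
  rw [ι_apply, mk_mul_mk, emptyWord_shuffle]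

theorem map_ι {B : Type v} [CommRing B] [Algebra C B] (f : A →ₐ[C] B) (a : A) :
    map C wt f (ι C wt A a) = ι C wt B (f a) := by
  rw [ι_apply, ι_apply, map_apply, mapLinear_mk, wordsMap_emptyWord]

variable {R : Type*} [CommRing R] [Algebra C R]

theorem algHom_ext_of_map_op {P : R → R} {f g : Sha C wt A →ₐ[C] R}
    (hf : ∀ x, f (op C wt A x) = P (f x)) (hg : ∀ x, g (op C wt A x) = P (g x))
    (h : ∀ a, f (ι C wt A a) = g (ι C wt A a)) : f = g := by
  have mk_eq_mul (a : A) (w : Words C A) : mk C wt A a w = ι C wt A a * mk C wt A 1 w := by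
    rw [ι_mul_mk, mul_one]
  have eq_on_one_mk (l : List A) : f (mk C wt A 1 (word C l)) = g (mk C wt A 1 (word C l)) := by
    induction l with
    | nil => rw [word, ← one_def, map_one, map_one]
    | cons a l ih => rw [word, ← op_mk, hf, hg, mk_eq_mul, map_mul, map_mul, h, ih]
  refine algHom_ext fun k x => ?_
  rw [incl_tprod, mk_eq_mul, map_mul, map_mul, h, eq_on_one_mk]

variable {P : R →ₗ[C] R} (hP : IsBaxterOperator wt P) (f : A →ₐ[C] R)

/-- The extension of `f : A →ₐ[C] R` to the shuffle Baxter algebra that commutes with the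
operators, given by `x₀ ⊗ x₁ ⊗ ⋯ ⊗ xₖ ↦ f x₀ * P (f x₁ * P (f x₂ * ⋯ P (f xₖ)))`. -/
def lift : Sha C wt A →ₐ[C] R :=
  AlgHom.ofLinearMap
    (descMk wt ((LinearMap.mul C R).compl₁₂ f.toLinearMap (evalWords P f.toLinearMap)))
    (by simp [one_def, descMk_mk, evalWords_emptyWord])
    (fun x y => by
      induction x using induction with
      | hmk a u =>
        induction y using induction with
        | hmk b v =>
          simp only [mk_mul_mk, descMk_mk, LinearMap.compl₁₂_apply, LinearMap.mul_apply_apply,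
            AlgHom.toLinearMap_apply, map_mul, hP.evalWords_shuffle]
          exact mul_mul_mul_comm _ _ _ _
        | hadd x y hx hy => simp only [mul_add, map_add, hx, hy]
      | hadd x y hx hy => simp only [add_mul, map_add, hx, hy])

theorem lift_mk (a : A) (w : Words C A) :
    lift hP f (mk C wt A a w) = f a * evalWords P f.toLinearMap w :=
  descMk_mk _ a w

theorem lift_op (x : Sha C wt A) : lift hP f (op C wt A x) = P (lift hP f x) := by
  induction x using induction with
  | hmk a w =>
    rw [op_mk, lift_mk, lift_mk, map_one, one_mul, evalWords_cons, AlgHom.toLinearMap_apply]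
  | hadd x y hx hy => simp only [map_add, hx, hy]

theorem lift_ι (a : A) : lift hP f (ι C wt A a) = f a := by
  rw [ι_apply, lift_mk, evalWords_emptyWord, mul_one]

end Sha

/-- The forgetful functor from Baxter `C`-algebras to commutative `C`-algebras. -/
def BaxCat.forgetOp (C : Type u) [CommRing C] (wt : C) :
    BaxCat.{u, v} C wt ⥤ CommAlgCat.{v} C where
  obj R := CommAlgCat.of C R.carrier
  map f := CommAlgCat.ofHom f.alg

section Adjunction

variable {C : Type u} [CommRing C] {wt : C}

/-- The universal property of the shuffle Baxter algebra: its Baxter algebra homomorphisms to `R`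
correspond to the algebra homomorphisms `A → R`. -/
def shaHomEquiv (A : CommAlgCat.{u} C) (R : BaxCat.{u, u} C wt) :
    ((shaFunctor C wt).obj A ⟶ R) ≃ (A ⟶ (BaxCat.forgetOp C wt).obj R) where
  toFun g := CommAlgCat.ofHom (g.alg.comp (Sha.ι C wt A))
  invFun f := ⟨Sha.lift R.op_mul_op f.hom, Sha.lift_op R.op_mul_op f.hom⟩
  left_inv g := BaxCat.hom_ext <|
    Sha.algHom_ext_of_map_op (Sha.lift_op R.op_mul_op _) g.map_op (Sha.lift_ι R.op_mul_op _)
  right_inv f := CommAlgCat.hom_ext <| AlgHom.ext <| Sha.lift_ι R.op_mul_op f.hom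

theorem shaHomEquiv_naturality_left {A B : CommAlgCat.{u} C} {R : BaxCat.{u, u} C wt} (f : A ⟶ B)
    (g : (shaFunctor C wt).obj B ⟶ R) :
    shaHomEquiv A R ((shaFunctor C wt).map f ≫ g) = f ≫ shaHomEquiv B R g :=
  CommAlgCat.hom_ext <| AlgHom.ext fun a => congrArg g.alg (Sha.map_ι f.hom a)

variable (C wt) in
/-- The shuffle Baxter algebra functor is the free Baxter algebra functor. -/
def shaAdjunction : shaFunctor C wt ⊣ BaxCat.forgetOp C wt :=
  Adjunction.mkOfHomEquiv
    { homEquiv := shaHomEquiv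
      homEquiv_naturality_left_symm := fun {_ _ R} f g => by
        rw [Equiv.symm_apply_eq, shaHomEquiv_naturality_left, Equiv.apply_symm_apply]
      homEquiv_naturality_right := fun _ _ => rfl }

instance : PreservesColimitsOfSize.{w', w} (shaFunctor C wt) :=
  (shaAdjunction C wt).leftAdjoint_preservesColimits

end Adjunction

end Baxter

end

theorem mainTheorem10_general {C : Type u} [CommRing C] (wt : C) {Λ : Type w} [Category.{w'} Λ]
    (F : Λ ⥤ CommAlgCat.{u} C) :
    (∀ [HasColimit F], ∃ _ : HasColimit (F ⋙ Baxter.shaFunctor C wt),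
      ∃ e : colimit (F ⋙ Baxter.shaFunctor C wt) ≅ (Baxter.shaFunctor C wt).obj (colimit F),
        ∀ i : Λ, colimit.ι (F ⋙ Baxter.shaFunctor C wt) i ≫ e.hom =
          (Baxter.shaFunctor C wt).map (colimit.ι F i)) ∧
    ∀ c : Cocone F, IsColimit c →
      Nonempty (IsColimit ((Baxter.shaFunctor C wt).mapCocone c)) :=
  ⟨⟨inferInstance, (preservesColimitIso _ F).symm, ι_preservesColimitIso_inv _ F⟩,
    fun _ hc => ⟨isColimitOfPreserves _ hc⟩⟩

theorem mainTheorem10 {C : Type u} [CommRing C] (wt : C) :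
    (∀ {Λ : Type u} [Category.{u} Λ] (F : Λ ⥤ CommAlgCat.{u} C),
      (∃ _ : HasColimit (F ⋙ Baxter.shaFunctor C wt),
        ∃ e : colimit (F ⋙ Baxter.shaFunctor C wt) ≅ (Baxter.shaFunctor C wt).obj (colimit F),
          ∀ i : Λ, colimit.ι (F ⋙ Baxter.shaFunctor C wt) i ≫ e.hom =
            (Baxter.shaFunctor C wt).map (colimit.ι F i)) ∧
      ∀ c : Cocone F, IsColimit c →
        Nonempty (IsColimit ((Baxter.shaFunctor C wt).mapCocone c))) ∧
    ∀ A B : CommAlgCat.{u} C,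
      Nonempty (IsColimit (BinaryCofan.mk
        ((Baxter.shaFunctor C wt).map
          (CommAlgCat.ofHom (Algebra.TensorProduct.includeLeft : A →ₐ[C] A ⊗[C] B)))
        ((Baxter.shaFunctor C wt).map
          (CommAlgCat.ofHom (Algebra.TensorProduct.includeRight : B →ₐ[C] A ⊗[C] B))))) :=
  ⟨fun F => ⟨(mainTheorem10_general wt F).1, (mainTheorem10_general wt F).2⟩, fun A B =>
    ((mainTheorem10_general wt (pair A B)).2 _ (CommAlgCat.binaryCofanIsColimit A B)).map
      (isColimitMapCoconeBinaryCofanEquiv _ _ _)⟩
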